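/- Let $\mathbb F=\mathbb R$ or $\mathbb C$, let $H$ be a Hilbert space over $\mathbb F$, let $\mathscr B(H)$ be the space of bounded linear operators on $H$ with the operator norm, and let $A\in\mathscr B(H)$ with $\|A\|=1$. Call $A$ a smooth point of the unit ball of $\mathscr B(H)$ if there is exactly one bounded linear functional $F$ on $\mathscr B(H)$ with $\|F\|=1$ and $F(A)=1$. Then $A$ is a smooth point of the unit ball of $\mathscr B(H)$ if and only if there is a vector $h\in H$ with $\|h\|=1$ such that $A$ attains its norm at $h$, i.e. $\|Ah\|=\|A\|$, and $$\sup_{x\perp h,\ \|x\|=1}\|Ax\|<\|A\|$$ (the supremum of the empty set being $0$). In that case, for every such $h$, the unit vectors at which $A$ attains its norm are exactly the vectors $ch$ with $c\in\mathbb F$, $|c|=1$ (that is, exactly $\pm h$ when $\mathbb F=\mathbb R$), and for every $B\in\mathscr B(H)$ $$\lim_{t\to 0}\frac{\|A+tB\|-\|A\|}{t}=\operatorname{Re}\langle Ah\,|\,Bh\rangle ,$$ where $t$ runs through the nonzero real numbers. -/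

import Mathlib

open Filter Topology

/-- `v` is a smooth point of the unit ball of the normed space `V` over `𝕜`: it has norm one and
there is a unique bounded `𝕜`-linear functional `F` with `‖F‖ = 1` and `F v = 1`. -/
def IsSmoothPointUnitBall (𝕜 : Type*) [RCLike 𝕜] {V : Type*} [NormedAddCommGroup V]
    [NormedSpace 𝕜 V] (v : V) : Prop :=
  ‖v‖ = 1 ∧ ∃! F : V →L[𝕜] 𝕜, ‖F‖ = 1 ∧ F v = 1

/-- The operator `A` attains its norm at the unit vector `h`. -/
def AttainsNormAt {𝕜 : Type*} [RCLike 𝕜] {H : Type*} [NormedAddCommGroup H]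
    [InnerProductSpace 𝕜 H] (A : H →L[𝕜] H) (h : H) : Prop :=
  ‖h‖ = 1 ∧ ‖A h‖ = ‖A‖

/-- The supremum of `‖A x‖` over the unit vectors `x` orthogonal to `h`. The values lie in
`[0, ‖A‖]`, so the supremum is a genuine one; if there is no such `x` (dimension one) it is `0`,
the supremum of the empty set in `[0, ∞)`. -/
noncomputable def supNormOrthogonal {𝕜 : Type*} [RCLike 𝕜] {H : Type*} [NormedAddCommGroup H]
    [InnerProductSpace 𝕜 H] (A : H →L[𝕜] H) (h : H) : ℝ :=
  sSup {r : ℝ | ∃ x : H, inner 𝕜 h x = 0 ∧ ‖x‖ = 1 ∧ r = ‖A x‖}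

/-! Near-maximizers of `A` are near-eigenvectors of `A*A` for the eigenvalue 1. By weak-*
compactness, a maximizing sequence `x n` yields a support functional whose value at `A ∘ P` is `lim
⟪x n, P (x n)⟫` whenever that limit exists. If `A` is smooth, no orthogonal projection `P` can
therefore separate two maximizing sequences. A norm that is not attained would give an orthonormal
maximizing sequence, whose even and odd terms are separated. A norm attained at `h` without a gap
would give a maximizing sequence in the complement of `h`, separated from the constant `h`.

Conversely, `A` maps `h` and its complement to orthogonal sets. With a gap `s < 1`, a component `y`
orthogonal to `h` costs `(1 - s²)‖y‖²` and gains only `O(|t|‖y‖)` under the perturbation `tB`, so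
`‖A + tB‖ ≤ 1 + t Re⟪Ah, Bh⟫ + Ct²`. Every support functional bounds the same norm below by its
tangent line. This forces uniqueness and gives the derivative. -/

section HilbertOperators

variable {𝕜 : Type*} [RCLike 𝕜] {H : Type*} [NormedAddCommGroup H] [InnerProductSpace 𝕜 H]

/-! ### Maximizing sequences and `A*A` -/

/-- Expand the square: the cross term is `-2‖A x‖²`, and `‖A* A x‖ ≤ ‖A x‖`. -/
lemma norm_adjoint_apply_sub_sq_le [CompleteSpace H] (A : H →L[𝕜] H) (hA : ‖A‖ = 1) (x : H) :
    ‖A.adjoint (A x) - x‖ ^ 2 ≤ ‖x‖ ^ 2 - ‖A x‖ ^ 2 := by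
  have h1 : ‖A.adjoint (A x)‖ ≤ ‖A x‖ := by
    have := A.adjoint.le_opNorm (A x)
    rwa [LinearIsometryEquiv.norm_map, hA, one_mul] at this
  have h2 : RCLike.re (inner 𝕜 (A.adjoint (A x)) x) = ‖A x‖ ^ 2 := by
    rw [ContinuousLinearMap.adjoint_inner_left, inner_self_eq_norm_sq]
  rw [norm_sub_sq (𝕜 := 𝕜), h2]
  nlinarith [norm_nonneg (A.adjoint (A x)), norm_nonneg (A x)]

lemma exists_unit_apply_gt (A : H →L[𝕜] H) (M : Submodule 𝕜 H) {s : ℝ}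
    {x : H} (hx : x ∈ M) (h : s * ‖x‖ < ‖A x‖) : ∃ u ∈ M, ‖u‖ = 1 ∧ s < ‖A u‖ := by
  have hx0 : x ≠ 0 := by
    rintro rfl
    simp at h
  have hn : 0 < ‖x‖ := norm_pos_iff.2 hx0
  refine ⟨((‖x‖⁻¹ : ℝ) : 𝕜) • x, M.smul_mem _ hx, ?_, ?_⟩
  · rw [norm_smul, RCLike.norm_ofReal, abs_of_pos (inv_pos.2 hn), inv_mul_cancel₀ hn.ne']
  · rw [map_smul, norm_smul, RCLike.norm_ofReal, abs_of_pos (inv_pos.2 hn), ← div_eq_inv_mul,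
      lt_div_iff₀ hn]
    exact h

lemma tendsto_one_of_one_sub_lt {u : ℕ → ℝ} (h1 : ∀ n, u n ≤ 1)
    (h2 : ∀ n : ℕ, 1 - 1 / ((n : ℝ) + 1) < u n) : Tendsto u atTop (𝓝 1) := by
  refine tendsto_of_tendsto_of_tendsto_of_le_of_le ?_ tendsto_const_nhds (fun n => (h2 n).le) h1
  simpa using (tendsto_one_div_add_atTop_nhds_zero_nat (𝕜 := ℝ)).const_sub 1

lemma one_sub_one_div_nonneg (n : ℕ) : (0 : ℝ) ≤ 1 - 1 / ((n : ℝ) + 1) := by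
  have : (1 : ℝ) / ((n : ℝ) + 1) ≤ 1 := by
    rw [div_le_one (by positivity)]
    linarith [Nat.cast_nonneg (α := ℝ) n]
  linarith

lemma one_sub_one_div_lt_one (n : ℕ) : 1 - 1 / ((n : ℝ) + 1) < 1 := by
  have : (0 : ℝ) < 1 / ((n : ℝ) + 1) := by positivity
  linarith

lemma norm_apply_le_of_norm_one {A : H →L[𝕜] H} (hA : ‖A‖ = 1) (x : H) : ‖A x‖ ≤ ‖x‖ := by
  simpa [hA] using A.le_opNorm x

lemma exists_maximizing_seq (A : H →L[𝕜] H) (hA : ‖A‖ = 1) :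
    ∃ x : ℕ → H, (∀ n, ‖x n‖ = 1) ∧ Tendsto (fun n => ‖A (x n)‖) atTop (𝓝 1) := by
  have key (n : ℕ) : ∃ u ∈ (⊤ : Submodule 𝕜 H), ‖u‖ = 1 ∧ 1 - 1 / ((n : ℝ) + 1) < ‖A u‖ := by
    have : ∃ x, (1 - 1 / ((n : ℝ) + 1)) * ‖x‖ < ‖A x‖ := by
      by_contra! hcon
      have := A.opNorm_le_bound (one_sub_one_div_nonneg n) hcon
      linarith [one_sub_one_div_lt_one n]
    obtain ⟨x, hx⟩ := this
    exact exists_unit_apply_gt A ⊤ Submodule.mem_top hx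
  choose x _ hx1 hx2 using key
  exact ⟨x, hx1, tendsto_one_of_one_sub_lt
    (fun n => (norm_apply_le_of_norm_one hA _).trans_eq (hx1 n)) hx2⟩

lemma tendsto_adjoint_apply_sub [CompleteSpace H] {A : H →L[𝕜] H} (hA : ‖A‖ = 1) {x : ℕ → H}
    (hx : ∀ n, ‖x n‖ = 1) (hAx : Tendsto (fun n => ‖A (x n)‖) atTop (𝓝 1)) :
    Tendsto (fun n => A.adjoint (A (x n)) - x n) atTop (𝓝 0) := by
  rw [tendsto_zero_iff_norm_tendsto_zero]
  have h0 : Tendsto (fun n => Real.sqrt (1 - ‖A (x n)‖ ^ 2)) atTop (𝓝 0) := by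
    simpa using ((hAx.pow 2).const_sub 1).sqrt
  refine squeeze_zero (fun _ => norm_nonneg _) (fun n => Real.le_sqrt_of_sq_le ?_) h0
  simpa [hx n] using norm_adjoint_apply_sub_sq_le A hA (x n)

/-! ### Norm attainment and orthonormal maximizing sequences -/

/-- A norm-one operator whose norm is strictly smaller on the orthogonal complement of a
finite-dimensional subspace attains its norm. -/
lemma exists_attainsNormAt_of_gap [CompleteSpace H] (A : H →L[𝕜] H) (hA : ‖A‖ = 1)
    (M : Submodule 𝕜 H) [FiniteDimensional 𝕜 M] {s : ℝ} (hs0 : 0 ≤ s) (hs : s < 1)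
    (hM : ∀ x ∈ Mᗮ, ‖A x‖ ≤ s * ‖x‖) : ∃ h, AttainsNormAt A h := by
  obtain ⟨x, hx, hAx⟩ := exists_maximizing_seq A hA
  have : ProperSpace M := FiniteDimensional.proper_rclike 𝕜 M
  obtain ⟨m, -, φ, hφ, hm⟩ := tendsto_subseq_of_bounded (x := fun n => M.orthogonalProjectionOnto (x n))
    (Metric.isBounded_closedBall (x := (0 : M)) (r := 1)) (fun n => by
      rw [mem_closedBall_zero_iff]
      exact (M.norm_orthogonalProjectionOnto_apply_le (x n)).trans_eq (hx n))
  let D : H →L[𝕜] H := ContinuousLinearMap.id 𝕜 H - A.adjoint ∘L A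
  have hD (z : H) : D z = z - A.adjoint (A z) := rfl
  -- The gap makes `1 - A*A` bounded below on `Mᗮ`, by Cauchy–Schwarz.
  have hbelow (z : H) (hz : z ∈ Mᗮ) : (1 - s ^ 2) * ‖z‖ ≤ ‖D z‖ := by
    rcases eq_or_ne z 0 with rfl | hz0
    · simp
    have hzp : 0 < ‖z‖ := norm_pos_iff.2 hz0
    have e1 : RCLike.re (inner 𝕜 (D z) z) = ‖z‖ ^ 2 - ‖A z‖ ^ 2 := by
      rw [hD, inner_sub_left, map_sub, ContinuousLinearMap.adjoint_inner_left,
        inner_self_eq_norm_sq, inner_self_eq_norm_sq]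
    have e2 := re_inner_le_norm (𝕜 := 𝕜) (D z) z
    have e3 : ‖A z‖ ^ 2 ≤ (s * ‖z‖) ^ 2 := pow_le_pow_left₀ (norm_nonneg _) (hM z hz) 2
    refine le_of_mul_le_mul_right ?_ hzp
    nlinarith
  have hs2 : 0 < 1 - s ^ 2 := by nlinarith
  let p : ℕ → H := fun n => M.orthogonalProjectionOnto (x (φ n))
  let y : ℕ → H := fun n => x (φ n) - p n
  have hy (n : ℕ) : y n ∈ Mᗮ := M.sub_starProjection_mem_orthogonal _
  have hp : Tendsto p atTop (𝓝 (m : H)) := (continuous_subtype_val.tendsto m).comp hm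
  have hDy : Tendsto (fun n => D (y n)) atTop (𝓝 (-D m)) := by
    have h1 : Tendsto (fun n => D (x (φ n))) atTop (𝓝 0) := by
      have := ((tendsto_adjoint_apply_sub hA hx hAx).comp hφ.tendsto_atTop).neg
      simpa [hD, Function.comp_def] using this
    have h2 := h1.sub ((D.continuous.tendsto _).comp hp)
    simpa [y, Function.comp_def] using h2
  -- `D (y n)` converges and `D` is bounded below on `Mᗮ`, so `y n` is Cauchy.
  have hycau : CauchySeq y := by
    have hc := Metric.cauchySeq_iff'.1 hDy.cauchySeq
    refine Metric.cauchySeq_iff'.2 fun ε hε => ?_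
    obtain ⟨N, hN⟩ := hc ((1 - s ^ 2) * ε) (by positivity)
    refine ⟨N, fun n hn => ?_⟩
    have h1 := hN n hn
    have h2 := hbelow (y n - y N) (Mᗮ.sub_mem (hy n) (hy N))
    rw [dist_eq_norm, ← map_sub] at h1
    rw [dist_eq_norm]
    exact lt_of_mul_lt_mul_left (h2.trans_lt h1) hs2.le
  obtain ⟨w, hw⟩ := cauchySeq_tendsto_of_complete hycau
  have hxl : Tendsto (fun n => x (φ n)) atTop (𝓝 (w + m)) := by
    simpa [y] using hw.add hp
  refine ⟨w + m, tendsto_nhds_unique hxl.norm (by simp [hx]), ?_⟩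
  rw [hA]
  exact tendsto_nhds_unique ((A.continuous.tendsto _).comp hxl).norm
    (hAx.comp hφ.tendsto_atTop)

/-- A norm-one operator that does not attain its norm has an orthogonal maximizing sequence. -/
lemma exists_orthogonal_maximizing_seq [CompleteSpace H] (A : H →L[𝕜] H) (hA : ‖A‖ = 1)
    (hne : ¬ ∃ h, AttainsNormAt A h) :
    ∃ e : ℕ → H, (∀ n, ‖e n‖ = 1) ∧ (∀ m n, m ≠ n → inner 𝕜 (e m) (e n) = 0) ∧
      Tendsto (fun n => ‖A (e n)‖) atTop (𝓝 1) := by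
  classical
  -- Each vector carries a strictly increasing index, so that the tolerances tend to zero.
  obtain ⟨f, hf, hr⟩ := exists_seq_of_forall_finset_exists
    (fun q : ℕ × H => ‖q.2‖ = 1 ∧ 1 - 1 / ((q.1 : ℝ) + 1) < ‖A q.2‖)
    (fun p q : ℕ × H => p.1 < q.1 ∧ inner 𝕜 p.2 q.2 = 0) (by
      intro S _
      let M : Submodule 𝕜 H := Submodule.span 𝕜 (S.image Prod.snd : Finset H)
      let N : ℕ := S.sup Prod.fst + 1
      have hex : ∃ x ∈ Mᗮ, (1 - 1 / ((N : ℝ) + 1)) * ‖x‖ < ‖A x‖ := by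
        by_contra! hcon
        exact hne (exists_attainsNormAt_of_gap A hA M (one_sub_one_div_nonneg N)
          (one_sub_one_div_lt_one N) hcon)
      obtain ⟨x, hxM, hx⟩ := hex
      obtain ⟨u, huM, hu1, hu⟩ := exists_unit_apply_gt A Mᗮ hxM hx
      refine ⟨(N, u), ⟨hu1, hu⟩, fun p hp => ⟨Nat.lt_succ_of_le (Finset.le_sup hp), ?_⟩⟩
      exact (Submodule.mem_orthogonal _ _).1 huM _
        (Submodule.subset_span (Finset.mem_coe.2 (Finset.mem_image_of_mem _ hp))))
  have hmono : StrictMono fun n => (f n).1 := fun m n h => (hr m n h).1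
  refine ⟨fun n => (f n).2, fun n => (hf n).1, fun m n hmn => ?_, ?_⟩
  · rcases lt_or_gt_of_ne hmn with h | h
    · exact (hr m n h).2
    · exact inner_eq_zero_symm.1 (hr n m h).2
  · refine tendsto_one_of_one_sub_lt
      (fun n => (norm_apply_le_of_norm_one hA _).trans_eq (hf n).1) fun n => ?_
    refine lt_of_le_of_lt ?_ (hf n).2
    have : (n : ℝ) ≤ (f n).1 := Nat.cast_le.2 (hmono.le_apply (x := n))
    have := one_div_le_one_div_of_le (by positivity : (0 : ℝ) < (n : ℝ) + 1)
      (add_le_add_left this 1)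
    linarith

/-! ### Support functionals from maximizing sequences -/

/-- The functional `B ↦ ⟪u, B x⟫` on operators. -/
noncomputable def innerApply (u x : H) : (H →L[𝕜] H) →L[𝕜] 𝕜 :=
  (innerSL 𝕜 u) ∘L (ContinuousLinearMap.apply 𝕜 H x)

lemma innerApply_apply (u x : H) (B : H →L[𝕜] H) : innerApply u x B = inner 𝕜 u (B x) := rfl

lemma norm_innerApply_le {u x : H} (hu : ‖u‖ ≤ 1) (hx : ‖x‖ ≤ 1) :
    ‖(innerApply u x : (H →L[𝕜] H) →L[𝕜] 𝕜)‖ ≤ 1 := by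
  refine ContinuousLinearMap.opNorm_le_bound _ zero_le_one fun B => ?_
  rw [innerApply_apply, one_mul]
  calc ‖inner 𝕜 u (B x)‖ ≤ ‖u‖ * ‖B x‖ := norm_inner_le_norm _ _
    _ ≤ 1 * (‖B‖ * 1) := by
      gcongr
      exact (B.le_opNorm x).trans (by gcongr)
    _ = ‖B‖ := by ring

lemma norm_eq_one_of_apply_eq_one {V : Type*} [NormedAddCommGroup V] [NormedSpace 𝕜 V]
    {F : V →L[𝕜] 𝕜} {v : V} (hv : ‖v‖ = 1) (hF : ‖F‖ ≤ 1) (hFv : F v = 1) : ‖F‖ = 1 := by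
  refine le_antisymm hF ?_
  have := F.le_opNorm v
  rwa [hFv, hv, norm_one, mul_one] at this

/-- A maximizing sequence yields a support functional that evaluates operators `A ∘ P` as limits
of the quadratic form of `P`. -/
lemma exists_support_functional [CompleteSpace H] {A : H →L[𝕜] H} (hA : ‖A‖ = 1) {x : ℕ → H}
    (hx : ∀ n, ‖x n‖ = 1) (hAx : Tendsto (fun n => ‖A (x n)‖) atTop (𝓝 1)) :
    ∃ F : (H →L[𝕜] H) →L[𝕜] 𝕜, (‖F‖ = 1 ∧ F A = 1) ∧ ∀ (P : H →L[𝕜] H) (c : 𝕜),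
      Tendsto (fun n => inner 𝕜 (x n) (P (x n))) atTop (𝓝 c) → F (A ∘L P) = c := by
  let G : ℕ → WeakDual 𝕜 (H →L[𝕜] H) :=
    fun n => StrongDual.toWeakDual (innerApply (A (x n)) (x n))
  have hG (n : ℕ) (B : H →L[𝕜] H) : G n B = inner 𝕜 (A (x n)) (B (x n)) := rfl
  have hcomp := WeakDual.isCompact_closedBall (0 : StrongDual 𝕜 (H →L[𝕜] H)) 1
  -- A free ultrafilter replaces a subsequence: the weak-* compact dual ball need not be
  -- sequentially compact.
  let U : Ultrafilter ℕ := hyperfilter ℕ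
  have hU : (U : Filter ℕ) ≤ atTop := Nat.hyperfilter_le_atTop
  obtain ⟨F, hF, hlim⟩ := hcomp.ultrafilter_le_nhds (U.map G) (by
    rw [le_principal_iff, Ultrafilter.mem_coe, Ultrafilter.mem_map]
    refine Filter.mem_of_superset Filter.univ_mem (fun n _ => ?_)
    have hn : (innerApply (A (x n)) (x n) : StrongDual 𝕜 (H →L[𝕜] H)) ∈
        Metric.closedBall (0 : StrongDual 𝕜 (H →L[𝕜] H)) 1 := by
      refine (mem_closedBall_zero_iff (E := StrongDual 𝕜 (H →L[𝕜] H))).2 ?_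
      exact norm_innerApply_le ((norm_apply_le_of_norm_one hA _).trans_eq (hx n)) (hx n).le
    exact hn)
  have heval (B : H →L[𝕜] H) : Tendsto (fun n => G n B) U (𝓝 (F B)) :=
    ((WeakDual.eval_continuous B).tendsto F).comp hlim
  have hcompP (P : H →L[𝕜] H) (c : 𝕜)
      (hP : Tendsto (fun n => inner 𝕜 (x n) (P (x n))) atTop (𝓝 c)) : F (A ∘L P) = c := by
    refine tendsto_nhds_unique (heval (A ∘L P)) (Tendsto.mono_left ?_ hU)
    -- `⟪A x, A P x⟫ = ⟪A* A x - x, P x⟫ + ⟪x, P x⟫`, and the first term tends to zero.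
    have h0 : Tendsto (fun n => inner 𝕜 (A.adjoint (A (x n)) - x n) (P (x n))) atTop (𝓝 0) := by
      refine squeeze_zero_norm (a := fun n => ‖A.adjoint (A (x n)) - x n‖ * ‖P‖) (fun n => ?_) ?_
      · refine (norm_inner_le_norm _ _).trans ?_
        gcongr
        simpa [hx n] using P.le_opNorm (x n)
      · simpa using (tendsto_adjoint_apply_sub hA hx hAx).norm.mul_const ‖P‖
    have h1 := h0.add hP
    rw [zero_add] at h1
    refine h1.congr fun n => ?_
    rw [hG, inner_sub_left, sub_add_cancel, ContinuousLinearMap.adjoint_inner_left]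
    rfl
  have hFA : F A = 1 := by
    have := hcompP (ContinuousLinearMap.id 𝕜 H) 1 (by
      simp [inner_self_eq_norm_sq_to_K, hx])
    simpa using this
  have hF1 : ‖WeakDual.toStrongDual F‖ ≤ 1 := by
    have : WeakDual.toStrongDual F ∈ Metric.closedBall (0 : StrongDual 𝕜 (H →L[𝕜] H)) 1 := hF
    exact (mem_closedBall_zero_iff (E := StrongDual 𝕜 (H →L[𝕜] H))).1 this
  exact ⟨WeakDual.toStrongDual F, ⟨norm_eq_one_of_apply_eq_one hA hF1 hFA, hFA⟩, hcompP⟩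

/-! ### Smoothness forces attainment and a gap -/

lemma IsSmoothPointUnitBall.quadratic_form_limits_eq [CompleteSpace H] {A : H →L[𝕜] H}
    (hS : IsSmoothPointUnitBall 𝕜 A) {x y : ℕ → H}
    (hx : ∀ n, ‖x n‖ = 1) (hAx : Tendsto (fun n => ‖A (x n)‖) atTop (𝓝 1))
    (hy : ∀ n, ‖y n‖ = 1) (hAy : Tendsto (fun n => ‖A (y n)‖) atTop (𝓝 1))
    (P : H →L[𝕜] H) {a b : 𝕜} (ha : ∀ n, inner 𝕜 (x n) (P (x n)) = a)
    (hb : ∀ n, inner 𝕜 (y n) (P (y n)) = b) : a = b := by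
  obtain ⟨hA, hU⟩ := hS
  obtain ⟨F, hF, hFx⟩ := exists_support_functional hA hx hAx
  obtain ⟨G, hG, hGy⟩ := exists_support_functional hA hy hAy
  have h1 := hFx P a (by simp [ha])
  have h2 := hGy P b (by simp [hb])
  rw [← h1, ← h2, hU.unique hF hG]

lemma IsSmoothPointUnitBall.exists_attainsNormAt [CompleteSpace H] {A : H →L[𝕜] H}
    (hS : IsSmoothPointUnitBall 𝕜 A) : ∃ h, AttainsNormAt A h := by
  by_contra hne
  obtain ⟨e, he1, heo, heA⟩ := exists_orthogonal_maximizing_seq A hS.1 hne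
  -- The projection onto the closed span of the even terms fixes them and kills the odd ones.
  let K : Submodule 𝕜 H :=
    (Submodule.span 𝕜 (Set.range fun n : ℕ => e (2 * n))).topologicalClosure
  have : CompleteSpace K :=
    (Submodule.isClosed_topologicalClosure _).completeSpace_coe
  have hmem (n : ℕ) : e (2 * n) ∈ K :=
    Submodule.le_topologicalClosure _ (Submodule.subset_span ⟨n, rfl⟩)
  have horth (n : ℕ) : e (2 * n + 1) ∈ Kᗮ := by
    rw [Submodule.orthogonal_closure, Submodule.mem_orthogonal]
    intro u hu
    induction hu using Submodule.span_induction with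
    | mem u hu =>
      obtain ⟨k, rfl⟩ := hu
      exact heo _ _ (by omega)
    | zero => simp
    | add u v _ _ h1 h2 => rw [inner_add_left, h1, h2, add_zero]
    | smul c u _ h1 => rw [inner_smul_left, h1, mul_zero]
  have hev : Tendsto (fun n : ℕ => 2 * n) atTop atTop :=
    tendsto_atTop_mono (fun n => (by omega : n ≤ _)) tendsto_id
  have hod : Tendsto (fun n : ℕ => 2 * n + 1) atTop atTop :=
    tendsto_atTop_mono (fun n => (by omega : n ≤ _)) tendsto_id
  have := hS.quadratic_form_limits_eq (x := fun n => e (2 * n)) (y := fun n => e (2 * n + 1))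
    (fun n => he1 _) (heA.comp hev) (fun n => he1 _) (heA.comp hod) K.starProjection
    (a := 1) (b := 0)
    (fun n => by
      rw [Submodule.starProjection_eq_self_iff.2 (hmem n), inner_self_eq_norm_sq_to_K, he1]
      simp)
    (fun n => by
      rw [(Submodule.starProjection_apply_eq_zero_iff K).2 (horth n), inner_zero_right])
  exact one_ne_zero this

lemma bddAbove_norm_orthogonal (A : H →L[𝕜] H) (h : H) :
    BddAbove {r : ℝ | ∃ x : H, inner 𝕜 h x = 0 ∧ ‖x‖ = 1 ∧ r = ‖A x‖} := by
  refine ⟨‖A‖, ?_⟩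
  rintro r ⟨x, -, hx, rfl⟩
  simpa [hx] using A.le_opNorm x

lemma supNormOrthogonal_nonneg (A : H →L[𝕜] H) (h : H) : 0 ≤ supNormOrthogonal A h := by
  refine Real.sSup_nonneg ?_
  rintro r ⟨x, -, -, rfl⟩
  exact norm_nonneg _

lemma norm_apply_le_supNormOrthogonal (A : H →L[𝕜] H) {h y : H} (hy : inner 𝕜 h y = 0) :
    ‖A y‖ ≤ supNormOrthogonal A h * ‖y‖ := by
  by_contra! hcon
  obtain ⟨u, huM, hu1, hu⟩ := exists_unit_apply_gt A (𝕜 ∙ h)ᗮ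
    (Submodule.mem_orthogonal_singleton_iff_inner_right.2 hy) hcon
  exact hu.not_ge (le_csSup (bddAbove_norm_orthogonal A h)
    ⟨u, Submodule.mem_orthogonal_singleton_iff_inner_right.1 huM, hu1, rfl⟩)

lemma IsSmoothPointUnitBall.supNormOrthogonal_lt [CompleteSpace H] {A : H →L[𝕜] H}
    (hS : IsSmoothPointUnitBall 𝕜 A) {h : H} (hh : AttainsNormAt A h) :
    supNormOrthogonal A h < ‖A‖ := by
  have hA := hS.1
  obtain ⟨hh1, hAh⟩ := hh
  by_contra! hcon
  have key (n : ℕ) : ∃ y : H, inner 𝕜 h y = 0 ∧ ‖y‖ = 1 ∧ 1 - 1 / ((n : ℝ) + 1) < ‖A y‖ := by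
    -- In dimension one the supremum is `0`, which contradicts `1 ≤ 0`.
    have hne : {r : ℝ | ∃ x : H, inner 𝕜 h x = 0 ∧ ‖x‖ = 1 ∧ r = ‖A x‖}.Nonempty := by
      by_contra hemp
      rw [Set.not_nonempty_iff_eq_empty] at hemp
      rw [supNormOrthogonal, hemp, Real.sSup_empty, hA] at hcon
      linarith
    obtain ⟨r, ⟨y, hy, hy1, rfl⟩, hr⟩ := exists_lt_of_lt_csSup hne
      ((one_sub_one_div_lt_one n).trans_le (hA.symm.le.trans hcon))
    exact ⟨y, hy, hy1, hr⟩
  choose y hy hy1 hy2 using key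
  have := hS.quadratic_form_limits_eq (x := fun _ => h) (y := y) (fun _ => hh1)
    (by simp [hAh, hA]) hy1
    (tendsto_one_of_one_sub_lt (fun n => (norm_apply_le_of_norm_one hA _).trans_eq (hy1 n)) hy2)
    (𝕜 ∙ h).starProjection (a := 1) (b := 0)
    (fun n => by
      rw [Submodule.starProjection_eq_self_iff.2 (Submodule.mem_span_singleton_self h),
        inner_self_eq_norm_sq_to_K, hh1]
      simp)
    (fun n => by
      rw [(Submodule.starProjection_apply_eq_zero_iff _).2
        (Submodule.mem_orthogonal_singleton_iff_inner_right.2 (hy n)), inner_zero_right])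
  exact one_ne_zero this

/-! ### Geometry around a norm-attaining vector -/

/-- The orthogonal decomposition along a unit vector. -/
lemma exists_orthogonal_decomposition {h : H} (hh : ‖h‖ = 1) (x : H) :
    ∃ (a : 𝕜) (y : H), x = a • h + y ∧ inner 𝕜 h y = 0 ∧ ‖a‖ ^ 2 + ‖y‖ ^ 2 = ‖x‖ ^ 2 := by
  have hy : inner 𝕜 h (x - (inner 𝕜 h x : 𝕜) • h) = 0 := by
    rw [inner_sub_right, inner_smul_right, inner_self_eq_norm_sq_to_K, hh]
    simp
  refine ⟨inner 𝕜 h x, x - (inner 𝕜 h x : 𝕜) • h, by simp, hy, ?_⟩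
  have := norm_add_sq_eq_norm_sq_add_norm_sq_of_inner_eq_zero (𝕜 := 𝕜) ((inner 𝕜 h x : 𝕜) • h)
    (x - (inner 𝕜 h x : 𝕜) • h) (by rw [inner_smul_left, hy, mul_zero])
  rw [add_sub_cancel, norm_smul, hh, mul_one] at this
  nlinarith

/-- At a maximizer, the bound on `‖A* A x - x‖²` is zero. -/
lemma AttainsNormAt.adjoint_apply_self [CompleteSpace H] {A : H →L[𝕜] H} (hA : ‖A‖ = 1) {h : H}
    (hh : AttainsNormAt A h) : A.adjoint (A h) = h := by
  have := norm_adjoint_apply_sub_sq_le A hA h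
  rw [hh.1, hh.2, hA, sub_self] at this
  exact sub_eq_zero.1 (norm_eq_zero.1 (pow_eq_zero_iff two_ne_zero |>.1
    (le_antisymm this (sq_nonneg _))))

lemma AttainsNormAt.inner_apply_eq_zero [CompleteSpace H] {A : H →L[𝕜] H} (hA : ‖A‖ = 1) {h y : H}
    (hh : AttainsNormAt A h) (hy : inner 𝕜 h y = 0) : inner 𝕜 (A h) (A y) = 0 := by
  rw [← ContinuousLinearMap.adjoint_inner_left, hh.adjoint_apply_self hA, hy]

lemma AttainsNormAt.norm_apply_sq_le [CompleteSpace H] {A : H →L[𝕜] H} (hA : ‖A‖ = 1) {h y : H}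
    (hh : AttainsNormAt A h) (hy : inner 𝕜 h y = 0) (a : 𝕜) :
    ‖A (a • h + y)‖ ^ 2 ≤ ‖a‖ ^ 2 + (supNormOrthogonal A h) ^ 2 * ‖y‖ ^ 2 := by
  have := norm_add_sq_eq_norm_sq_add_norm_sq_of_inner_eq_zero (𝕜 := 𝕜) (a • A h) (A y)
    (by rw [inner_smul_left, hh.inner_apply_eq_zero hA hy, mul_zero])
  rw [norm_smul, hh.2, hA, mul_one] at this
  rw [map_add, map_smul]
  have h2 := pow_le_pow_left₀ (norm_nonneg _) (norm_apply_le_supNormOrthogonal A hy) 2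
  nlinarith

lemma AttainsNormAt.attainsNormAt_iff [CompleteSpace H] {A : H →L[𝕜] H} (hA : ‖A‖ = 1) {h : H}
    (hh : AttainsNormAt A h) (hs : supNormOrthogonal A h < ‖A‖) (x : H) :
    AttainsNormAt A x ↔ ∃ c : 𝕜, ‖c‖ = 1 ∧ x = c • h := by
  constructor
  · rintro ⟨hx1, hAx⟩
    obtain ⟨a, y, rfl, hy, hn⟩ := exists_orthogonal_decomposition (𝕜 := 𝕜) hh.1 x
    have h1 := hh.norm_apply_sq_le hA hy a
    rw [hAx, hA] at h1
    rw [hx1] at hn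
    rw [hA] at hs
    have h0 := supNormOrthogonal_nonneg A h
    have hs2 : 0 < 1 - supNormOrthogonal A h ^ 2 := by nlinarith
    -- `‖a‖² + ‖y‖² = 1 ≤ ‖a‖² + s²‖y‖²` with `s < 1` leaves no room for `y`.
    have hy0 : ‖y‖ ^ 2 = 0 := by
      by_contra hne
      have : 0 < ‖y‖ ^ 2 := lt_of_le_of_ne (sq_nonneg _) (Ne.symm hne)
      nlinarith
    have hy00 : y = 0 := norm_eq_zero.1 (pow_eq_zero_iff two_ne_zero |>.1 hy0)
    subst hy00
    refine ⟨a, ?_, add_zero _⟩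
    rw [hy0, add_zero] at hn
    nlinarith [norm_nonneg a]
  · rintro ⟨c, hc, rfl⟩
    exact ⟨by rw [norm_smul, hc, hh.1, one_mul], by rw [map_smul, norm_smul, hc, hh.2, one_mul]⟩

/-- The 4 counts two cross terms, the `y`–`y` term and the defect `1 - ‖a‖² = ‖y‖²`, each
contributing at most `‖B‖ * ‖y‖`. -/
lemma re_inner_apply_sub_le (A B : H →L[𝕜] H) (hA : ‖A‖ = 1) {h y : H} (hh : ‖h‖ = 1) (a : 𝕜)
    (hn : ‖a‖ ^ 2 + ‖y‖ ^ 2 = 1) :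
    |RCLike.re (inner 𝕜 (A (a • h + y)) (B (a • h + y))) - RCLike.re (inner 𝕜 (A h) (B h))|
      ≤ 4 * ‖B‖ * ‖y‖ := by
  have ha : ‖a‖ ≤ 1 := by nlinarith [norm_nonneg a, sq_nonneg ‖y‖]
  have hy : ‖y‖ ≤ 1 := by nlinarith [norm_nonneg y, sq_nonneg ‖a‖]
  have bound (u v : H) : |RCLike.re (inner 𝕜 (A u) (B v))| ≤ ‖u‖ * (‖B‖ * ‖v‖) :=
    (RCLike.abs_re_le_norm _).trans ((norm_inner_le_norm _ _).trans
      (mul_le_mul (norm_apply_le_of_norm_one hA u) (B.le_opNorm v) (norm_nonneg _) (norm_nonneg _)))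
  have e1 : RCLike.re (inner 𝕜 (A (a • h)) (B (a • h)))
      = ‖a‖ ^ 2 * RCLike.re (inner 𝕜 (A h) (B h)) := by
    rw [map_smul, map_smul, inner_smul_left, inner_smul_right, ← mul_assoc, RCLike.conj_mul,
      ← RCLike.ofReal_pow, RCLike.re_ofReal_mul]
  have e2 : RCLike.re (inner 𝕜 (A (a • h + y)) (B (a • h + y)))
      = ‖a‖ ^ 2 * RCLike.re (inner 𝕜 (A h) (B h)) + RCLike.re (inner 𝕜 (A (a • h)) (B y))
        + RCLike.re (inner 𝕜 (A y) (B (a • h))) + RCLike.re (inner 𝕜 (A y) (B y)) := by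
    rw [← e1, map_add A, map_add B, inner_add_left, inner_add_right, inner_add_right]
    simp only [map_add]
    ring
  have hah : ‖a • h‖ ≤ 1 := by rwa [norm_smul, hh, mul_one]
  have hBy : 0 ≤ ‖B‖ * ‖y‖ := by positivity
  have b1 : |RCLike.re (inner 𝕜 (A (a • h)) (B y))| ≤ ‖B‖ * ‖y‖ :=
    (bound _ _).trans (mul_le_of_le_one_left hBy hah)
  have b2 : |RCLike.re (inner 𝕜 (A y) (B (a • h)))| ≤ ‖B‖ * ‖y‖ :=
    (bound _ _).trans (by nlinarith [mul_le_of_le_one_right hBy hah])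
  have b3 : |RCLike.re (inner 𝕜 (A y) (B y))| ≤ ‖B‖ * ‖y‖ :=
    (bound _ _).trans (mul_le_of_le_one_left hBy hy)
  have b4 : |‖y‖ ^ 2 * RCLike.re (inner 𝕜 (A h) (B h))| ≤ ‖B‖ * ‖y‖ := by
    have := bound h h
    rw [hh, one_mul, mul_one] at this
    rw [abs_mul, abs_of_nonneg (sq_nonneg _)]
    calc ‖y‖ ^ 2 * |RCLike.re (inner 𝕜 (A h) (B h))| ≤ (1 * ‖y‖) * ‖B‖ := by
          rw [sq]; gcongr
      _ = ‖B‖ * ‖y‖ := by ring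
  rw [e2, eq_sub_of_add_eq hn]
  rw [abs_le] at *
  constructor <;> linarith [b1.1, b1.2, b2.1, b2.2, b3.1, b3.2, b4.1, b4.2]

/-! ### Norm expansion, uniqueness and derivative -/

/-- A second-order upper bound for the norm along every line through `A`. -/
lemma AttainsNormAt.norm_add_smul_le [CompleteSpace H] {A : H →L[𝕜] H} (hA : ‖A‖ = 1) {h : H}
    (hh : AttainsNormAt A h) (hs : supNormOrthogonal A h < ‖A‖) (B : H →L[𝕜] H) :
    ∃ C : ℝ, ∀ t : ℝ,
      ‖A + (t : 𝕜) • B‖ ≤ 1 + t * RCLike.re (inner 𝕜 (A h) (B h)) + C * t ^ 2 := by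
  rw [hA] at hs
  set s := supNormOrthogonal A h with hsdef
  set β := RCLike.re (inner 𝕜 (A h) (B h)) with hβ
  have h0 : 0 ≤ s := supNormOrthogonal_nonneg A h
  have hd : 0 < 1 - s ^ 2 := by nlinarith
  -- The first term is the maximum over `‖y‖` of `8‖B‖|t|‖y‖ - (1 - s²)‖y‖²`, divided by `t²`; the
  -- second bounds `‖B x‖²`.
  let C : ℝ := 16 * ‖B‖ ^ 2 / (1 - s ^ 2) + ‖B‖ ^ 2
  have hunit (t : ℝ) (x : H) (hx : ‖x‖ = 1) :
      ‖(A + (t : 𝕜) • B) x‖ ^ 2 ≤ 1 + 2 * t * β + C * t ^ 2 := by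
    obtain ⟨a, y, rfl, hy, hn⟩ := exists_orthogonal_decomposition (𝕜 := 𝕜) hh.1 x
    have h1 := hh.norm_apply_sq_le hA hy a
    rw [hx, one_pow] at hn
    have h2 := re_inner_apply_sub_le A B hA hh.1 a hn
    rw [← hsdef] at h1
    rw [← hβ] at h2
    set x := a • h + y
    have h3 : ‖(A + (t : 𝕜) • B) x‖ ^ 2
        = ‖A x‖ ^ 2 + 2 * (t * RCLike.re (inner 𝕜 (A x) (B x))) + t ^ 2 * ‖B x‖ ^ 2 := by
      rw [add_apply, smul_apply, norm_add_sq (𝕜 := 𝕜),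
        inner_smul_right, RCLike.re_ofReal_mul, norm_smul, RCLike.norm_ofReal, mul_pow, sq_abs]
    have h4 : ‖B x‖ ^ 2 ≤ ‖B‖ ^ 2 :=
      pow_le_pow_left₀ (norm_nonneg _) (by simpa [hx] using B.le_opNorm x) 2
    have h5 : t * RCLike.re (inner 𝕜 (A x) (B x)) ≤ t * β + |t| * (4 * ‖B‖ * ‖y‖) := by
      have := le_abs_self (t * (RCLike.re (inner 𝕜 (A x) (B x)) - β))
      rw [abs_mul] at this
      have := this.trans (mul_le_mul_of_nonneg_left h2 (abs_nonneg t))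
      linarith
    have h6 : 2 * (|t| * (4 * ‖B‖ * ‖y‖)) - (1 - s ^ 2) * ‖y‖ ^ 2
        ≤ 16 * ‖B‖ ^ 2 / (1 - s ^ 2) * t ^ 2 := by
      rw [div_mul_eq_mul_div, le_div_iff₀ hd, ← sq_abs t]
      nlinarith [sq_nonneg ((1 - s ^ 2) * ‖y‖ - 4 * ‖B‖ * |t|)]
    have h7 : t ^ 2 * ‖B x‖ ^ 2 ≤ ‖B‖ ^ 2 * t ^ 2 := by nlinarith [sq_nonneg t]
    have hC : C * t ^ 2 = 16 * ‖B‖ ^ 2 / (1 - s ^ 2) * t ^ 2 + ‖B‖ ^ 2 * t ^ 2 := by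
      simp only [C]; ring
    rw [h3, hC]
    linarith
  refine ⟨C / 2, fun t => ?_⟩
  have hle (x : H) (hx : ‖x‖ = 1) :
      ‖(A + (t : 𝕜) • B) x‖ ≤ 1 + t * β + C / 2 * t ^ 2 := by
    -- `2r ≤ 1 + r²` passes from the square to the norm and halves `C`.
    nlinarith [hunit t x hx, sq_nonneg (‖(A + (t : 𝕜) • B) x‖ - 1)]
  have hr : 0 ≤ 1 + t * β + C / 2 * t ^ 2 := (norm_nonneg _).trans (hle h hh.1)
  by_contra! hcon
  have : ∃ x, (1 + t * β + C / 2 * t ^ 2) * ‖x‖ < ‖(A + (t : 𝕜) • B) x‖ := by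
    by_contra! hcon2
    exact hcon.not_ge (ContinuousLinearMap.opNorm_le_bound _ hr hcon2)
  obtain ⟨x, hx⟩ := this
  obtain ⟨u, -, hu1, hu⟩ := exists_unit_apply_gt _ ⊤ Submodule.mem_top hx
  exact hu.not_ge (hle u hu1)

lemma support_functional_le_norm_add_smul {V : Type*} [NormedAddCommGroup V] [NormedSpace 𝕜 V]
    {F : V →L[𝕜] 𝕜} (hF : ‖F‖ = 1) {v : V} (hFv : F v = 1) (w : V) (t : ℝ) :
    1 + t * RCLike.re (F w) ≤ ‖v + (t : 𝕜) • w‖ := by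
  have h1 : RCLike.re (F (v + (t : 𝕜) • w)) = 1 + t * RCLike.re (F w) := by
    rw [map_add, map_smul, hFv, smul_eq_mul, map_add, RCLike.re_ofReal_mul, RCLike.one_re]
  rw [← h1]
  refine (RCLike.re_le_norm _).trans ?_
  simpa [hF] using F.le_opNorm (v + (t : 𝕜) • w)

lemma AttainsNormAt.innerApply_support {A : H →L[𝕜] H} (hA : ‖A‖ = 1) {h : H}
    (hh : AttainsNormAt A h) :
    ‖(innerApply (A h) h : (H →L[𝕜] H) →L[𝕜] 𝕜)‖ = 1 ∧ innerApply (A h) h A = (1 : 𝕜) := by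
  have h1 : innerApply (A h) h A = (1 : 𝕜) := by
    rw [innerApply_apply, inner_self_eq_norm_sq_to_K, hh.2, hA]
    simp
  exact ⟨norm_eq_one_of_apply_eq_one hA (norm_innerApply_le (hh.2.trans hA).le hh.1.le) h1, h1⟩

lemma eq_of_forall_mul_le {a b C : ℝ} (h : ∀ t : ℝ, t * a ≤ t * b + C * t ^ 2) : a = b := by
  have hC : a - b = 0 := by
    have key (t : ℝ) : t * (a - b) ≤ |C| * t ^ 2 := by
      nlinarith [h t, mul_le_mul_of_nonneg_right (le_abs_self C) (sq_nonneg t)]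
    by_contra hne
    have hp : 0 < (a - b) ^ 2 := by positivity
    have hc : 0 < |C| + 1 := by positivity
    -- A multiple of `a - b` gives `t` the right sign; the factor `1 / (|C| + 1)` makes the
    -- quadratic term strictly smaller than the linear one.
    have h1 := key ((a - b) / (|C| + 1))
    have h2 : (a - b) / (|C| + 1) * (a - b) = (a - b) ^ 2 / (|C| + 1) := by ring
    have h3 : |C| * ((a - b) / (|C| + 1)) ^ 2
        = (a - b) ^ 2 / (|C| + 1) * (|C| / (|C| + 1)) := by
      field_simp
    have h4 : |C| / (|C| + 1) < 1 := by
      rw [div_lt_one hc]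
      linarith
    have h5 : 0 < (a - b) ^ 2 / (|C| + 1) := by positivity
    rw [h2, h3] at h1
    nlinarith
  linarith

lemma ext_of_re_eq {V : Type*} [NormedAddCommGroup V] [NormedSpace 𝕜 V] {F G : V →L[𝕜] 𝕜}
    (h : ∀ v, RCLike.re (F v) = RCLike.re (G v)) : F = G := by
  ext v
  -- This multiple of `v` turns the difference of the values into the real number `‖F v - G v‖²`.
  have h1 := h ((starRingEnd 𝕜) (F v - G v) • v)
  rw [F.map_smul, G.map_smul, ← sub_eq_zero, ← map_sub, ← smul_sub, smul_eq_mul, RCLike.conj_mul,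
    ← RCLike.ofReal_pow, RCLike.ofReal_re] at h1
  exact sub_eq_zero.1 (norm_eq_zero.1 (pow_eq_zero_iff two_ne_zero |>.1 h1))

lemma AttainsNormAt.isSmoothPointUnitBall [CompleteSpace H] {A : H →L[𝕜] H} (hA : ‖A‖ = 1) {h : H}
    (hh : AttainsNormAt A h) (hs : supNormOrthogonal A h < ‖A‖) : IsSmoothPointUnitBall 𝕜 A := by
  refine ⟨hA, innerApply (A h) h, hh.innerApply_support hA, ?_⟩
  rintro F ⟨hF, hFA⟩
  refine ext_of_re_eq fun B => ?_
  obtain ⟨C, hC⟩ := hh.norm_add_smul_le hA hs B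
  refine eq_of_forall_mul_le (C := C) fun t => ?_
  have := (support_functional_le_norm_add_smul hF hFA B t).trans (hC t)
  rw [innerApply_apply]
  linarith

lemma AttainsNormAt.tendsto_norm_quotient [CompleteSpace H] {A : H →L[𝕜] H} (hA : ‖A‖ = 1) {h : H}
    (hh : AttainsNormAt A h) (hs : supNormOrthogonal A h < ‖A‖) (B : H →L[𝕜] H) :
    Tendsto (fun t : ℝ => (‖A + (t : 𝕜) • B‖ - ‖A‖) / t) (𝓝[≠] 0)
      (𝓝 (RCLike.re (inner 𝕜 (A h) (B h)))) := by
  obtain ⟨C, hC⟩ := hh.norm_add_smul_le hA hs B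
  obtain ⟨hF, hFA⟩ := hh.innerApply_support hA
  set β := RCLike.re (inner 𝕜 (A h) (B h)) with hβ
  rw [tendsto_iff_norm_sub_tendsto_zero]
  have hlim : Tendsto (fun t : ℝ => C * |t|) (𝓝[≠] 0) (𝓝 0) := by
    have : Continuous fun t : ℝ => C * |t| := by fun_prop
    simpa using (this.tendsto 0).mono_left nhdsWithin_le_nhds
  refine tendsto_of_tendsto_of_tendsto_of_le_of_le' tendsto_const_nhds hlim
    (Eventually.of_forall fun _ => norm_nonneg _) ?_
  filter_upwards [self_mem_nhdsWithin] with t ht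
  have ht0 : t ≠ 0 := ht
  have hl := support_functional_le_norm_add_smul hF hFA B t
  rw [innerApply_apply, ← hβ] at hl
  have hu := hC t
  have e : (‖A + (t : 𝕜) • B‖ - ‖A‖) / t - β = (‖A + (t : 𝕜) • B‖ - 1 - t * β) / t := by
    rw [hA]
    field_simp
  -- The numerator lies between `0` (support functional) and `C * t ^ 2`.
  rw [e, Real.norm_eq_abs, abs_div, div_le_iff₀ (abs_pos.2 ht0), mul_assoc, ← sq, sq_abs,
    abs_of_nonneg (by linarith)]
  linarith

end HilbertOperators

theorem mainTheorem7 {𝕜 : Type*} [RCLike 𝕜] {H : Type*} [NormedAddCommGroup H]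
    [InnerProductSpace 𝕜 H] [CompleteSpace H] (A : H →L[𝕜] H) (hA : ‖A‖ = 1) :
    (IsSmoothPointUnitBall 𝕜 A ↔
      ∃ h : H, AttainsNormAt A h ∧ supNormOrthogonal A h < ‖A‖) ∧
    ∀ h : H, AttainsNormAt A h → supNormOrthogonal A h < ‖A‖ →
      (∀ x : H, AttainsNormAt A x ↔ ∃ c : 𝕜, ‖c‖ = 1 ∧ x = c • h) ∧
      ∀ B : H →L[𝕜] H,
        Tendsto (fun t : ℝ => (‖A + (t : 𝕜) • B‖ - ‖A‖) / t) (𝓝[≠] 0)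
          (𝓝 (RCLike.re (inner 𝕜 (A h) (B h)))) := by
  refine ⟨⟨fun hS => ?_, fun ⟨h, hh, hs⟩ => hh.isSmoothPointUnitBall hA hs⟩, fun h hh hs =>
    ⟨hh.attainsNormAt_iff hA hs, hh.tendsto_norm_quotient hA hs⟩⟩
  obtain ⟨h, hh⟩ := hS.exists_attainsNormAt
  exact ⟨h, hh, hS.supNormOrthogonal_lt hh⟩
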